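/- Let $U\subset\mathbb{R}^n$ be a nonempty open set and let $F:U\to\mathbb{R}^m$ be locally Lipschitz. A set-valued map $J_F:U\rightrightarrows\mathbb{R}^{m\times n}$ is called a conservative Jacobian for $F$ if it has nonempty values, its graph is closed in $U\times\mathbb{R}^{m\times n}$, it is locally bounded, and for every absolutely continuous curve $\gamma:[0,1]\to U$ one has, for almost every $t\in[0,1]$, $$\frac{\mathrm{d}}{\mathrm{d}t}F(\gamma(t)) = A\,\dot\gamma(t)\qquad\text{for all } A\in J_F(\gamma(t)).$$ The Clarke Jacobian of $F$ at $x\in U$ is $$\mathrm{Jac}^c F(x)=\operatorname{conv}\Big\{\lim_{k\to\infty}\mathrm{Jac}\,F(x_k)\;:\;x_k\in U,\ F\text{ differentiable at }x_k,\ x_k\to x\Big\},$$ where $\mathrm{Jac}\,F(y)\in\mathbb{R}^{m\times n}$ is the usual Jacobian matrix of $F$ at a point $y$ of differentiability, and only sequences for which the limit exists are considered. Theorem (the Clarke Jacobian is a minimal conservative Jacobian). Let $J_F$ be a conservative Jacobian for $F$ such that $J_F(x)$ is convex for every $x\in U$. Then for almost every $x\in U$ (with respect to Lebesgue measure), $F$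 is differentiable at $x$ and $J_F(x)=\{\mathrm{Jac}\,F(x)\}$. Moreover, $\mathrm{Jac}^c F(x)\subset J_F(x)$ for every $x\in U$. -/

import Mathlib

open Filter Topology MeasureTheory Set

noncomputable section

/-- The Jacobian matrix of `F` at `x`: its `(i, j)` entry is the derivative of the `i`-th component
of `F` in the direction of the `j`-th basis vector. It is only meaningful where `F` is
differentiable. -/
def jacobianMatrix {n m : ℕ} (F : EuclideanSpace ℝ (Fin n) → EuclideanSpace ℝ (Fin m))
    (x : EuclideanSpace ℝ (Fin n)) : Matrix (Fin m) (Fin n) ℝ :=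
  Matrix.of fun i j => (fderiv ℝ F x (EuclideanSpace.single j (1 : ℝ))) i

/-- The Clarke Jacobian at `x` of a function `F` defined on `U`: the convex hull of all limits of
Jacobian matrices of `F` along sequences of points of differentiability of `F` in `U` that
converge to `x`. -/
def clarkeJacobian {n m : ℕ} (U : Set (EuclideanSpace ℝ (Fin n)))
    (F : EuclideanSpace ℝ (Fin n) → EuclideanSpace ℝ (Fin m))
    (x : EuclideanSpace ℝ (Fin n)) : Set (Matrix (Fin m) (Fin n) ℝ) :=
  convexHull ℝ {A | ∃ u : ℕ → EuclideanSpace ℝ (Fin n),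
    (∀ k, u k ∈ U ∧ DifferentiableAt ℝ F (u k)) ∧
    Tendsto u atTop (𝓝 x) ∧
    Tendsto (fun k => jacobianMatrix F (u k)) atTop (𝓝 A)}

/-- `J` is a conservative Jacobian for `F` on the open set `U`. The values of `F` and `J` outside
`U` play no role. -/
structure IsConservativeJacobian {n m : ℕ} (U : Set (EuclideanSpace ℝ (Fin n)))
    (F : EuclideanSpace ℝ (Fin n) → EuclideanSpace ℝ (Fin m))
    (J : EuclideanSpace ℝ (Fin n) → Set (Matrix (Fin m) (Fin n) ℝ)) : Prop where
  nonempty : ∀ x ∈ U, (J x).Nonempty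
  /-- The graph of `J` over `U` is closed in `U × ℝ^(m × n)`. -/
  closed_graph : IsClosed {p : U × Matrix (Fin m) (Fin n) ℝ | p.2 ∈ J (p.1 : EuclideanSpace ℝ (Fin n))}
  /-- `J` is locally bounded: near each point of `U` the entries of its elements are bounded. -/
  locally_bounded : ∀ x ∈ U, ∃ M : ℝ, ∀ᶠ u in 𝓝[U] x, ∀ A ∈ J u, ∀ i j, |A i j| ≤ M
  /-- The chain rule along every absolutely continuous curve `γ : [0, 1] → U`: for almost every
  `t`, the derivative of `F ∘ γ` at `t` is `A γ'(t)`, whatever the choice of `A ∈ J (γ t)`. -/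
  chain_rule : ∀ γ : ℝ → EuclideanSpace ℝ (Fin n),
    AbsolutelyContinuousOnInterval γ 0 1 → (∀ t ∈ Icc (0 : ℝ) 1, γ t ∈ U) →
    ∀ᵐ t ∂(volume.restrict (Ioo (0 : ℝ) 1)), ∀ A ∈ J (γ t),
      HasDerivAt (fun s => F (γ s)) (WithLp.toLp 2 (A.mulVec (deriv γ t).ofLp)) t

end

/-! The chain rule along segments in the direction `e_j` determines column `j` of every element of
`J`; Fubini turns this into `J = {Jac F}` almost everywhere (`ae_eq_singleton`).

The Clarke Jacobian uses every point of differentiability, including those in the exceptional null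
set, so `jacobianMatrix_mem` must reach each such `y`. Were `Jac F y` outside the convex set `J y`,
a functional `φ` would separate them. By upper semicontinuity `φ (Jac F z - Jac F y)` would be at
most some `-δ` for almost every `z` near `y`. Integrated by parts against a tent of radius `r`, this
pairing is only `o(r)` times the volume of the ball, because the first-order remainder of `F` at `y`
is `o(r)`; but the bound `-δ` forces order `r` (`not_ae_sum_lineDeriv_le_neg`). Closed graph and
convexity then absorb limits and hulls. -/

/-- The tent function of radius `r` centred at `y`. -/
def tent {E : Type*} [NormedAddCommGroup E] (y : E) (r : ℝ) (z : E) : ℝ := max 0 (r - ‖z - y‖)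

/-! ### Testing derivatives of Lipschitz functions against tents -/

section Tent

variable {E : Type*} [NormedAddCommGroup E] {y : E} {r : ℝ}

theorem tent_nonneg (z : E) : 0 ≤ tent y r z := le_max_left _ _

theorem lipschitzWith_tent : LipschitzWith 1 (tent y r) := by
  have h : LipschitzWith 1 fun z : E => r - ‖z - y‖ := by
    refine LipschitzWith.of_dist_le_mul fun a b => ?_
    rw [Real.dist_eq, NNReal.coe_one, one_mul, dist_eq_norm]
    have := abs_norm_sub_norm_le (b - y) (a - y)
    rw [show b - y - (a - y) = -(a - b) by abel, norm_neg] at this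
    rwa [show r - ‖a - y‖ - (r - ‖b - y‖) = ‖b - y‖ - ‖a - y‖ by ring]
  exact h.const_max 0

theorem tent_eq_zero {z : E} (hz : z ∉ Metric.closedBall y r) : tent y r z = 0 := by
  rw [Metric.mem_closedBall, dist_eq_norm, not_le] at hz
  exact max_eq_left (by linarith)

theorem hasCompactSupport_tent [ProperSpace E] : HasCompactSupport (tent y r) :=
  HasCompactSupport.intro (isCompact_closedBall y r) fun _ hz => tent_eq_zero hz

variable [NormedSpace ℝ E]

theorem lineDeriv_tent_eq_zero {z : E} (hz : z ∉ Metric.closedBall y r) (v : E) :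
    lineDeriv ℝ (tent y r) z v = 0 := by
  have h : tent y r =ᶠ[𝓝 z] fun _ => 0 :=
    (Metric.isClosed_closedBall.isOpen_compl.eventually_mem hz).mono fun _ => tent_eq_zero
  rw [h.lineDeriv_eq]
  simp [lineDeriv]

variable [FiniteDimensional ℝ E] [MeasurableSpace E] [BorelSpace E] (μ : Measure E)
  [μ.IsAddHaarMeasure]

/-- Integration by parts moves the derivative onto the tent, which is 1-Lipschitz and vanishes off
the ball, so only the size of `f` matters. -/
theorem abs_integral_lineDeriv_mul_tent_le {C : NNReal} {f : E → ℝ} (hf : LipschitzWith C f)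
    {η : ℝ} (hη : ∀ z ∈ Metric.closedBall y r, |f z| ≤ η) (v : E) :
    |∫ z, lineDeriv ℝ f z v * tent y r z ∂μ| ≤ ‖v‖ * η * μ.real (Metric.closedBall y r) := by
  have : ProperSpace E := FiniteDimensional.proper ℝ E
  rw [hf.integral_lineDeriv_mul_eq lipschitzWith_tent hasCompactSupport_tent,
    ← setIntegral_eq_integral_of_forall_compl_eq_zero (s := Metric.closedBall y r)
      fun z hz => by rw [lineDeriv_tent_eq_zero hz, zero_mul], ← Real.norm_eq_abs]
  refine norm_setIntegral_le_of_norm_le_const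
    (isCompact_closedBall y r).measure_lt_top fun z hz => ?_
  rw [norm_mul]
  have h := norm_lineDeriv_le_of_lipschitz (x₀ := z) (v := -v) ℝ (lipschitzWith_tent (y := y) (r := r))
  rw [NNReal.coe_one, one_mul, norm_neg] at h
  exact mul_le_mul h (hη z hz) (norm_nonneg _) (norm_nonneg _)

/-- The tent is at least `r / 2` on the concentric ball of radius `r / 2`. -/
theorem le_integral_tent (hr : 0 < r) :
    r / 2 * ((1 / 2) ^ Module.finrank ℝ E * μ.real (Metric.closedBall y r)) ≤
      ∫ z, tent y r z ∂μ := by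
  have : ProperSpace E := FiniteDimensional.proper ℝ E
  have hint : Integrable (tent y r) μ :=
    lipschitzWith_tent.continuous.integrable_of_hasCompactSupport hasCompactSupport_tent
  have hvol : (1 / 2) ^ Module.finrank ℝ E * μ.real (Metric.closedBall y r) =
      μ.real (Metric.closedBall y (r / 2)) := by
    rw [Measure.addHaar_real_closedBall μ y hr.le, Measure.addHaar_real_closedBall μ y (by positivity),
      ← mul_assoc, ← mul_pow]
    ring_nf
  rw [hvol]
  calc r / 2 * μ.real (Metric.closedBall y (r / 2))
      = ∫ z in Metric.closedBall y (r / 2), r / 2 ∂μ := by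
        rw [setIntegral_const, smul_eq_mul, mul_comm]
    _ ≤ ∫ z in Metric.closedBall y (r / 2), tent y r z ∂μ := by
        refine setIntegral_mono_on ?_ hint.integrableOn Metric.isClosed_closedBall.measurableSet
          fun z hz => ?_
        · exact integrableOn_const (isCompact_closedBall y _).measure_lt_top.ne
        · rw [Metric.mem_closedBall, dist_eq_norm] at hz
          exact le_max_of_le_right (by linarith)
    _ ≤ ∫ z, tent y r z ∂μ :=
        setIntegral_le_integral hint (Eventually.of_forall tent_nonneg)

/-- Lipschitz functions with vanishing derivative at `y` cannot have directional derivatives with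
a weighted sum that is bounded away from zero on one side almost everywhere near `y`. -/
theorem not_ae_sum_lineDeriv_le_neg {ι : Type*} [Fintype ι] {C : ι → NNReal} {f : ι → E → ℝ}
    (hf : ∀ k, LipschitzWith (C k) (f k)) (hy : ∀ k, f k =o[𝓝 y] fun z => z - y)
    (b : ι → ℝ) (v : ι → E) {δ : ℝ} (hδ : 0 < δ) :
    ¬ ∀ᶠ r in 𝓝[>] (0 : ℝ), ∀ᵐ z ∂μ, z ∈ Metric.closedBall y r →
      ∑ k, b k * lineDeriv ℝ (f k) z (v k) ≤ -δ := by
  intro H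
  have : ProperSpace E := FiniteDimensional.proper ℝ E
  set S : ℝ := ∑ k, |b k| * ‖v k‖ with hS
  have hS0 : 0 ≤ S := Finset.sum_nonneg fun k _ => by positivity
  set c : ℝ := δ / 2 * (1 / 2) ^ Module.finrank ℝ E with hc
  have hc0 : 0 < c := by positivity
  -- Chosen so that `S * ε < c`: the upper estimate `S * ε * r * V` then falls below the lower one,
  -- `c * r * V`. The `+ 1` covers `S = 0`.
  set ε : ℝ := c / (S + 1) with hε
  have hε0 : 0 < ε := by positivity
  have hsmall : ∀ᶠ r in 𝓝[>] (0 : ℝ), ∀ z ∈ Metric.closedBall y r, ∀ k, |f k z| ≤ ε * r := by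
    have h : ∀ᶠ z in 𝓝 y, ∀ k, ‖f k z‖ ≤ ε * ‖z - y‖ :=
      eventually_all.2 fun k => (hy k).bound hε0
    obtain ⟨ρ, hρ, hb⟩ := Metric.eventually_nhds_iff.1 h
    filter_upwards [Ioo_mem_nhdsGT hρ] with r hr z hz k
    rw [Metric.mem_closedBall] at hz
    refine (hb (hz.trans_lt hr.2) k).trans ?_
    rw [← dist_eq_norm]
    gcongr
  obtain ⟨r, ⟨hae, hle⟩, hr⟩ := ((H.and hsmall).and self_mem_nhdsWithin).exists
  replace hr : 0 < r := hr
  set V := μ.real (Metric.closedBall y r) with hV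
  have hV0 : 0 < V :=
    ENNReal.toReal_pos (Metric.measure_closedBall_pos μ y hr).ne'
      (isCompact_closedBall y r).measure_lt_top.ne
  have hint : Integrable (tent y r) μ :=
    lipschitzWith_tent.continuous.integrable_of_hasCompactSupport hasCompactSupport_tent
  have hintk : ∀ k, Integrable (fun z => lineDeriv ℝ (f k) z (v k) * tent y r z) μ := fun k =>
    hint.bdd_mul (c := C k * ‖v k‖) (aestronglyMeasurable_lineDeriv (hf k).continuous μ)
      (Eventually.of_forall fun z => norm_lineDeriv_le_of_lipschitz ℝ (hf k))
  have hupper : ∑ k, b k * ∫ z, lineDeriv ℝ (f k) z (v k) * tent y r z ∂μ ≤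
      -δ * ∫ z, tent y r z ∂μ := by
    simp_rw [← integral_const_mul]
    rw [← integral_finsetSum _ fun k _ => (hintk k).const_mul _]
    refine integral_mono_ae (integrable_finsetSum _ fun k _ => (hintk k).const_mul _)
      (hint.const_mul _) ?_
    filter_upwards [hae] with z hz
    simp_rw [← mul_assoc]
    rw [← Finset.sum_mul]
    by_cases hzr : z ∈ Metric.closedBall y r
    · exact mul_le_mul_of_nonneg_right (hz hzr) (tent_nonneg z)
    · rw [tent_eq_zero hzr, mul_zero, mul_zero]
  have hlower : -(S * (ε * r) * V) ≤
      ∑ k, b k * ∫ z, lineDeriv ℝ (f k) z (v k) * tent y r z ∂μ := by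
    rw [hS, Finset.sum_mul, Finset.sum_mul, ← Finset.sum_neg_distrib]
    refine Finset.sum_le_sum fun k _ => ?_
    refine neg_le_of_abs_le ?_
    rw [abs_mul, mul_assoc, mul_assoc, ← mul_assoc ‖v k‖]
    exact mul_le_mul_of_nonneg_left
      (abs_integral_lineDeriv_mul_tent_le μ (hf k) (fun z hz => hle z hz k) (v k)) (abs_nonneg _)
  have htent := mul_le_mul_of_nonneg_left (le_integral_tent (y := y) μ hr) hδ.le
  have hSε : S * ε < c := by
    rw [hε, mul_div_assoc', div_lt_iff₀ (by positivity)]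
    nlinarith
  have : S * ε * (r * V) < c * (r * V) := mul_lt_mul_of_pos_right hSε (by positivity)
  have hcr : δ * (r / 2 * ((1 / 2) ^ Module.finrank ℝ E * V)) = c * (r * V) := by
    rw [hc]; ring
  rw [← hV, hcr] at htent
  nlinarith

end Tent
-- Upper semicontinuity and measurability
section Conservative

variable {n m : ℕ} {U : Set (EuclideanSpace ℝ (Fin n))}
  {F : EuclideanSpace ℝ (Fin n) → EuclideanSpace ℝ (Fin m)}
  {J : EuclideanSpace ℝ (Fin n) → Set (Matrix (Fin m) (Fin n) ℝ)}

theorem jacobianMatrix_apply (x : EuclideanSpace ℝ (Fin n)) (i : Fin m) (j : Fin n) :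
    jacobianMatrix F x i j = fderiv ℝ F x (EuclideanSpace.single j (1 : ℝ)) i := rfl

theorem measurable_jacobianMatrix_apply (i : Fin m) (j : Fin n) :
    Measurable fun x => jacobianMatrix F x i j :=
  (EuclideanSpace.proj (𝕜 := ℝ) i).continuous.measurable.comp
    (measurable_fderiv_apply_const ℝ F (EuclideanSpace.single j (1 : ℝ)))

/-- A locally Lipschitz function on an open set is differentiable almost everywhere in it. -/
theorem LocallyLipschitzOn.ae_differentiableAt_of_isOpen (hF : LocallyLipschitzOn U F)
    (hU : IsOpen U) : ∀ᵐ x, x ∈ U → DifferentiableAt ℝ F x := by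
  rw [ae_iff]
  refine measure_null_of_locally_null _ fun x hx => ?_
  simp only [mem_ofPred_eq, Classical.not_imp] at hx
  obtain ⟨K, t, ht, hK⟩ := hF hx.1
  rw [hU.nhdsWithin_eq hx.1] at ht
  obtain ⟨V, hVt, hV, hxV⟩ := mem_nhds_iff.1 ht
  refine ⟨_, inter_mem_nhdsWithin _ (hV.mem_nhds hxV), ?_⟩
  have h := ((hK.mono hVt).ae_differentiableWithinAt_of_mem (μ := volume))
  rw [ae_iff] at h
  refine measure_mono_null (fun z hz => ?_) h
  simp only [mem_inter_iff, mem_ofPred_eq, Classical.not_imp] at hz ⊢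
  exact ⟨hz.2, fun hd => hz.1.2 (hd.differentiableAt (hV.mem_nhds hz.2))⟩

namespace IsConservativeJacobian

theorem isClosed_apply (hJ : IsConservativeJacobian U F J) {x : EuclideanSpace ℝ (Fin n)}
    (hx : x ∈ U) : IsClosed (J x) :=
  hJ.closed_graph.preimage (f := fun A => ((⟨x, hx⟩ : U), A)) (by fun_prop)

/-- Upper semicontinuity: local boundedness confines nearby values to a compact box, and the closed
graph excludes a neighbourhood of each point of `C` in it. -/
theorem eventually_forall_notMem (hJ : IsConservativeJacobian U F J)
    {x : EuclideanSpace ℝ (Fin n)} (hx : x ∈ U) {C : Set (Matrix (Fin m) (Fin n) ℝ)}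
    (hC : IsClosed C) (h : ∀ A ∈ J x, A ∉ C) : ∀ᶠ z in 𝓝[U] x, ∀ A ∈ J z, A ∉ C := by
  obtain ⟨M, hM⟩ := hJ.locally_bounded x hx
  have hK : IsCompact (C ∩ {A : Matrix (Fin m) (Fin n) ℝ | ∀ i j, A i j ∈ Icc (-M) M}) := by
    refine IsCompact.inter_left ?_ hC
    have := isCompact_univ_pi fun _ : Fin m =>
      isCompact_univ_pi fun _ : Fin n => isCompact_Icc (a := -M) (b := M)
    convert! this using 1
    ext A
    exact ⟨fun h i _ j _ => h i j, fun h i j => h i trivial j trivial⟩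
  have hP := hK.eventually_forall_of_forall_eventually (x₀ := (⟨x, hx⟩ : U))
    (P := fun z A => A ∉ J (z : EuclideanSpace ℝ (Fin n)))
    fun A hA => hJ.closed_graph.isOpen_compl.eventually_mem fun hAJ => h A hAJ hA.1
  rw [eventually_nhds_subtype_iff U ⟨x, hx⟩ fun z => ∀ A ∈ C ∩ {A : Matrix (Fin m) (Fin n) ℝ |
    ∀ i j, A i j ∈ Icc (-M) M}, A ∉ J z] at hP
  filter_upwards [hP, hM] with z hz hzM A hA hAC
  exact hz A ⟨hAC, fun i j => abs_le.1 (hzM A hA i j)⟩ hA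

theorem measurableSet_exists_mem (hJ : IsConservativeJacobian U F J) (hU : IsOpen U)
    {C : Set (Matrix (Fin m) (Fin n) ℝ)} (hC : IsClosed C) :
    MeasurableSet {x | x ∈ U ∧ ∃ A ∈ J x, A ∈ C} := by
  have h : IsOpen {x | x ∈ U ∧ ∀ A ∈ J x, A ∉ C} := by
    refine isOpen_iff_mem_nhds.2 fun x hx => ?_
    have := hJ.eventually_forall_notMem hx.1 hC hx.2
    rw [hU.nhdsWithin_eq hx.1] at this
    exact (hU.eventually_mem hx.1).and this
  convert! hU.measurableSet.diff h.measurableSet using 1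
  ext x
  simp only [mem_ofPred_eq, Set.mem_sdiff]
  push Not
  tauto

/-- A rational between `A i j` and `g x` reduces the condition to countably many closed ones on `A`.
Fubini needs this measurability. -/
theorem measurableSet_exists_apply_ne (hJ : IsConservativeJacobian U F J) (hU : IsOpen U)
    (i : Fin m) (j : Fin n) {g : EuclideanSpace ℝ (Fin n) → ℝ} (hg : Measurable g) :
    MeasurableSet {x | x ∈ U ∧ ∃ A ∈ J x, A i j ≠ g x} := by
  have hcont : Continuous fun A : Matrix (Fin m) (Fin n) ℝ => A i j := by fun_prop
  have h1 : MeasurableSet (⋃ q : ℚ, {x | x ∈ U ∧ ∃ A ∈ J x, A ∈ {A | (q : ℝ) ≤ A i j}} ∩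
      {x | g x < q}) :=
    .iUnion fun q => (hJ.measurableSet_exists_mem hU (isClosed_le continuous_const hcont)).inter
      (measurableSet_lt hg measurable_const)
  have h2 : MeasurableSet (⋃ q : ℚ, {x | x ∈ U ∧ ∃ A ∈ J x, A ∈ {A | A i j ≤ (q : ℝ)}} ∩
      {x | q < g x}) :=
    .iUnion fun q => (hJ.measurableSet_exists_mem hU (isClosed_le hcont continuous_const)).inter
      (measurableSet_lt measurable_const hg)
  convert! h1.union h2 using 1
  ext x
  simp only [mem_ofPred_eq, mem_union, mem_iUnion, mem_inter_iff]
  constructor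
  · rintro ⟨hx, A, hA, hne⟩
    rcases hne.lt_or_gt with h | h
    · obtain ⟨q, hq1, hq2⟩ := exists_rat_btwn h
      exact Or.inr ⟨q, ⟨hx, A, hA, hq1.le⟩, hq2⟩
    · obtain ⟨q, hq1, hq2⟩ := exists_rat_btwn h
      exact Or.inl ⟨q, ⟨hx, A, hA, hq2.le⟩, hq1⟩
  · rintro (⟨q, ⟨hx, A, hA, h⟩, hq⟩ | ⟨q, ⟨hx, A, hA, h⟩, hq⟩)
    · exact ⟨hx, A, hA, (hq.trans_le h).ne'⟩
    · exact ⟨hx, A, hA, (h.trans_lt hq).ne⟩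

/-! ### From segments to almost every point -/

/-- The chain rule along segments, at the points of differentiability of `F`. -/
theorem ae_segment (hJ : IsConservativeJacobian U F J) {y v : EuclideanSpace ℝ (Fin n)}
    (hseg : ∀ t ∈ Icc (0 : ℝ) 1, y + t • v ∈ U) :
    ∀ᵐ t ∂(volume.restrict (Ioo (0 : ℝ) 1)), DifferentiableAt ℝ F (y + t • v) →
      ∀ A ∈ J (y + t • v), WithLp.toLp 2 (A.mulVec v.ofLp) = fderiv ℝ F (y + t • v) v := by
  have hd : ∀ t : ℝ, HasDerivAt (fun s : ℝ => y + s • v) v t := fun t => by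
    simpa using ((hasDerivAt_id t).smul_const v).const_add y
  have hac : AbsolutelyContinuousOnInterval (fun s : ℝ => y + s • v) 0 1 :=
    ContDiffOn.absolutelyContinuousOnInterval (by fun_prop)
  filter_upwards [hJ.chain_rule _ hac hseg] with t ht hF A hA
  have h := ht A hA
  rw [(hd t).deriv] at h
  exact h.unique (hF.hasFDerivAt.comp_hasDerivAt t (hd t))

/-- The property is local in `t`: a short interval around `t₀` is an affine image of `[0, 1]`, and
affine maps preserve null sets. -/
theorem ae_line (hJ : IsConservativeJacobian U F J) (hU : IsOpen U)
    (y v : EuclideanSpace ℝ (Fin n)) :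
    ∀ᵐ t : ℝ, y + t • v ∈ U → DifferentiableAt ℝ F (y + t • v) →
      ∀ A ∈ J (y + t • v), WithLp.toLp 2 (A.mulVec v.ofLp) = fderiv ℝ F (y + t • v) v := by
  rw [ae_iff]
  refine measure_null_of_locally_null _ fun t₀ ht₀ => ?_
  simp only [mem_ofPred_eq, Classical.not_imp] at ht₀
  have hopen : IsOpen ((fun t : ℝ => y + t • v) ⁻¹' U) := hU.preimage (by fun_prop)
  obtain ⟨δ, hδ, hball⟩ := Metric.nhds_basis_closedBall.mem_iff.1 (hopen.mem_nhds ht₀.1)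
  refine ⟨_, inter_mem_nhdsWithin _ (Metric.ball_mem_nhds t₀ hδ), ?_⟩
  have hpt : ∀ s : ℝ, y + (t₀ - δ) • v + s • ((2 * δ) • v) = y + (t₀ - δ + s * (2 * δ)) • v :=
    fun s => by module
  have hseg := hJ.ae_segment (y := y + (t₀ - δ) • v) (v := (2 * δ) • v) fun s hs => by
    rw [hpt]
    refine hball ?_
    rw [Metric.mem_closedBall, Real.dist_eq, abs_le]
    constructor <;> nlinarith [hs.1, hs.2]
  rw [ae_restrict_iff' measurableSet_Ioo, ae_iff] at hseg
  refine measure_mono_null ?_ (addHaar_image_eq_zero_of_differentiableOn_of_addHaar_eq_zero volume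
    (f := fun s : ℝ => t₀ - δ + s * (2 * δ)) (by fun_prop) hseg)
  rintro t ⟨ht, htδ⟩
  rw [Metric.mem_ball, Real.dist_eq, abs_lt] at htδ
  have hts : t₀ - δ + (t - (t₀ - δ)) / (2 * δ) * (2 * δ) = t := by field_simp; ring
  refine ⟨(t - (t₀ - δ)) / (2 * δ), ?_, hts⟩
  simp only [mem_ofPred_eq, Classical.not_imp, not_forall] at ht ⊢
  obtain ⟨-, hF, A, hA, hne⟩ := ht
  rw [hpt, hts]
  refine ⟨⟨div_pos (by linarith) (by positivity), (div_lt_one (by positivity)).2 (by linarith)⟩,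
    hF, A, hA, fun h => hne ?_⟩
  rw [WithLp.ofLp_smul, Matrix.mulVec_smul, WithLp.toLp_smul, map_smul] at h
  exact smul_right_injective _ (by positivity : 2 * δ ≠ 0) h

theorem ae_apply_eq (hJ : IsConservativeJacobian U F J) (hU : IsOpen U) (i : Fin m) (j : Fin n) :
    ∀ᵐ x, x ∈ U → DifferentiableAt ℝ F x → ∀ A ∈ J x, A i j = jacobianMatrix F x i j := by
  have hmeas : MeasurableSet ({x | x ∈ U ∧ ∃ A ∈ J x, A i j ≠ jacobianMatrix F x i j} ∩
      {x | DifferentiableAt ℝ F x})ᶜ :=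
    ((hJ.measurableSet_exists_apply_ne hU i j (measurable_jacobianMatrix_apply i j)).inter
      (measurableSet_of_differentiableAt ℝ F)).compl
  have h := ae_mem_of_ae_add_linearMap_mem
    (LinearMap.toSpanSingleton ℝ _ (EuclideanSpace.single j (1 : ℝ))) volume volume hmeas
    fun y => by
      filter_upwards [hJ.ae_line hU y (EuclideanSpace.single j (1 : ℝ))] with t ht
      rw [LinearMap.toSpanSingleton_apply]
      rintro ⟨⟨hx, A, hA, hne⟩, hd⟩
      refine hne ?_
      have := congrArg (fun w : EuclideanSpace ℝ (Fin m) => w i) (ht hx hd A hA)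
      simpa [jacobianMatrix_apply] using this
  filter_upwards [h] with x hx hxU hd A hA
  by_contra hne
  exact hx ⟨⟨hxU, A, hA, hne⟩, hd⟩

theorem ae_eq_singleton (hJ : IsConservativeJacobian U F J) (hU : IsOpen U)
    (hF : LocallyLipschitzOn U F) :
    ∀ᵐ x, x ∈ U → DifferentiableAt ℝ F x ∧ J x = {jacobianMatrix F x} := by
  filter_upwards [hF.ae_differentiableAt_of_isOpen hU,
    ae_all_iff.2 fun i => ae_all_iff.2 fun j => hJ.ae_apply_eq hU i j] with x hd hx hxU
  refine ⟨hd hxU, (hJ.nonempty x hxU).subset_singleton_iff.1 fun A hA => ?_⟩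
  ext i j
  exact hx i j hxU (hd hxU) A hA

/-! ### Points of differentiability and the Clarke Jacobian -/

/-- A conservative Jacobian with convex values contains the Jacobian matrix at every point of
differentiability. -/
theorem jacobianMatrix_mem (hJ : IsConservativeJacobian U F J) (hU : IsOpen U)
    (hF : LocallyLipschitzOn U F) {y : EuclideanSpace ℝ (Fin n)} (hy : y ∈ U)
    (hconv : Convex ℝ (J y)) (hd : DifferentiableAt ℝ F y) : jacobianMatrix F y ∈ J y := by
  by_contra hnot
  obtain ⟨φ, u, hφJ, hφy⟩ : ∃ (φ : StrongDual ℝ (Fin m → Fin n → ℝ)) (u : ℝ),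
      (∀ A ∈ J y, φ A < u) ∧ u < φ (jacobianMatrix F y) :=
    geometric_hahn_banach_closed_point hconv (hJ.isClosed_apply hy) hnot
  have hφsum : ∀ A : Matrix (Fin m) (Fin n) ℝ,
      φ A = ∑ k : Fin m × Fin n, φ (Matrix.single k.1 k.2 1) * A k.1 k.2 := fun A => by
    rw [Fintype.sum_prod_type]
    conv_lhs => rw [Matrix.matrix_eq_sum_single A]
    refine (map_sum φ _ _).trans (Finset.sum_congr rfl fun i _ => ?_)
    refine (map_sum φ _ _).trans (Finset.sum_congr rfl fun j _ => ?_)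
    rw [show Matrix.single i j (A i j) = A i j • Matrix.single i j (1 : ℝ) by simp]
    exact (map_smul φ _ _).trans (mul_comm _ _)
  obtain ⟨K, t, ht, hK⟩ := hF hy
  rw [hU.nhdsWithin_eq hy] at ht
  let p : Fin m → EuclideanSpace ℝ (Fin m) →L[ℝ] ℝ := fun i => EuclideanSpace.proj i
  -- Integration by parts is applied to globally Lipschitz functions, so each component is extended
  -- from `t`.
  have hlip : ∀ i, ∃ g : EuclideanSpace ℝ (Fin n) → ℝ, LipschitzWith (‖p i‖₊ * K) g ∧
      EqOn (fun z => p i (F z)) g t := fun i =>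
    LipschitzOnWith.extend_real ((p i).lipschitz.comp_lipschitzOnWith hK)
  choose g hg hgF using hlip
  have hgF' : ∀ i, ∀ z ∈ interior t, g i =ᶠ[𝓝 z] fun z => p i (F z) := fun i z hz =>
    ((hgF i).eventuallyEq_of_mem (mem_interior_iff_mem_nhds.1 hz)).symm
  have hderiv : ∀ i, ∀ z ∈ interior t, DifferentiableAt ℝ F z →
      HasFDerivAt (g i) ((p i).comp (fderiv ℝ F z)) z := fun i z hz hdz =>
    ((p i).hasFDerivAt.comp z hdz.hasFDerivAt).congr_of_eventuallyEq (hgF' i z hz)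
  let L : Fin m → EuclideanSpace ℝ (Fin n) →L[ℝ] ℝ := fun i => (p i).comp (fderiv ℝ F y)
  have hclosed : IsClosed {A : Matrix (Fin m) (Fin n) ℝ | u ≤ φ A} :=
    isClosed_le continuous_const φ.continuous
  have hnear : ∀ᶠ z in 𝓝 y, z ∈ U ∧ z ∈ interior t ∧ ∀ A ∈ J z, φ A < u := by
    have := hJ.eventually_forall_notMem hy hclosed fun A hA => not_le.2 (hφJ A hA)
    rw [hU.nhdsWithin_eq hy] at this
    filter_upwards [hU.eventually_mem hy, interior_mem_nhds.2 ht, this] with z h1 h2 h3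
    exact ⟨h1, h2, fun A hA => not_le.1 (h3 A hA)⟩
  have hnear' : ∀ᶠ r in 𝓝[>] (0 : ℝ), ∀ z ∈ Metric.closedBall y r,
      z ∈ U ∧ z ∈ interior t ∧ ∀ A ∈ J z, φ A < u := by
    obtain ⟨ρ, hρ, hb⟩ := Metric.eventually_nhds_iff.1 hnear
    filter_upwards [Ioo_mem_nhdsGT hρ] with r hr z hz
    exact hb ((Metric.mem_closedBall.1 hz).trans_lt hr.2)
  -- The test functions are the first-order remainders at `y`; the weights are the coefficients of
  -- `φ`, and `δ = φ (Jac F y) - u`.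
  refine not_ae_sum_lineDeriv_le_neg (y := y) volume
    (f := fun (k : Fin m × Fin n) z => g k.1 z - (L k.1 z + (p k.1 (F y) - L k.1 y)))
    (fun k => (hg k.1).sub ((L k.1).lipschitz.add (LipschitzWith.const _))) (fun k => ?_)
    (fun k => φ (Matrix.single k.1 k.2 1)) (fun k => EuclideanSpace.single k.2 (1 : ℝ))
    (sub_pos.2 hφy) ?_
  · have h := (hderiv k.1 y (mem_interior_iff_mem_nhds.2 ht) hd).isLittleO
    refine h.congr_left fun z => ?_
    rw [map_sub, ← hgF k.1 (mem_of_mem_nhds ht)]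
    simp only [L]
    ring
  · filter_upwards [hnear'] with r hr
    filter_upwards [hJ.ae_eq_singleton hU hF] with z hz hzr
    obtain ⟨hzU, hzt, hzJ⟩ := hr z hzr
    obtain ⟨hdz, hJz⟩ := hz hzU
    have hφz : φ (jacobianMatrix F z) < u := hzJ _ (hJz ▸ mem_singleton _)
    have hline : ∀ k : Fin m × Fin n,
        lineDeriv ℝ (fun z => g k.1 z - (L k.1 z + (p k.1 (F y) - L k.1 y))) z
          (EuclideanSpace.single k.2 (1 : ℝ)) =
        jacobianMatrix F z k.1 k.2 - jacobianMatrix F y k.1 k.2 := fun k =>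
      (((hderiv k.1 z hzt hdz).sub
        ((L k.1).hasFDerivAt.add_const _)).hasLineDerivAt _).lineDeriv
    simp_rw [hline, mul_sub, Finset.sum_sub_distrib, ← hφsum]
    linarith

theorem clarkeJacobian_subset (hJ : IsConservativeJacobian U F J) (hU : IsOpen U)
    (hF : LocallyLipschitzOn U F) (hconv : ∀ x ∈ U, Convex ℝ (J x))
    {x : EuclideanSpace ℝ (Fin n)} (hx : x ∈ U) : clarkeJacobian U F x ⊆ J x := by
  refine convexHull_min ?_ (hconv x hx)
  rintro A ⟨u, hu, hux, huA⟩
  have hlim : Tendsto (fun k => ((⟨u k, (hu k).1⟩ : U), jacobianMatrix F (u k))) atTop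
      (𝓝 (⟨x, hx⟩, A)) :=
    (tendsto_subtype_rng.2 hux).prodMk_nhds huA
  exact hJ.closed_graph.mem_of_tendsto hlim (Eventually.of_forall fun k =>
    hJ.jacobianMatrix_mem hU hF (hu k).1 (hconv _ (hu k).1) (hu k).2)

end IsConservativeJacobian

end Conservative

theorem theorem1 {n m : ℕ} (U : Set (EuclideanSpace ℝ (Fin n))) (hU : IsOpen U)
    (F : EuclideanSpace ℝ (Fin n) → EuclideanSpace ℝ (Fin m)) (hF : LocallyLipschitzOn U F)
    (J : EuclideanSpace ℝ (Fin n) → Set (Matrix (Fin m) (Fin n) ℝ))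
    (hJ : IsConservativeJacobian U F J) (hconv : ∀ x ∈ U, Convex ℝ (J x)) :
    (∀ᵐ x ∂(volume.restrict U), DifferentiableAt ℝ F x ∧ J x = {jacobianMatrix F x}) ∧
      ∀ x ∈ U, clarkeJacobian U F x ⊆ J x :=
  ⟨(ae_restrict_iff' hU.measurableSet).2 (hJ.ae_eq_singleton hU hF),
    fun _ hx => hJ.clarkeJacobian_subset hU hF hconv hx⟩
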